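/- Corollary 3 (Identifiability of linear DAEs with full-state measurement). Let $E\in\mathbb R^{n\times n}$ (possibly singular), let $A:\mathbb R^p\to\mathbb R^{n\times n}$ have entries that are differentiable at $\theta_0\in\mathbb R^p$ (for instance, $\theta$ may list the unknown entries of $A$), and consider the parametrised linear descriptor system $$E\dot x=A(\theta)x,\qquad y=Cx,\qquad C=I_n .$$ A solution for the parameter value $\theta$ on $[t_0,t_0+T]$, $T>0$, is a $C^1$ function on that interval satisfying the equation (one-sided derivatives at the end points); $x_0$ is called consistent for $\theta$ if for some $T>0$ there is a solution on $[t_0,t_0+T]$ for $\theta$ with $x(t_0)=x_0$. Let $x$ be a solution on some interval $[t_0,t_0+T]$, $T>0$, for $\theta_0$ with $x(t_0)=x_0$, and suppose that it is the unique one, in the sense that every solution for $\theta_0$ with initial value $x_0$ on an interval $[t_0,t_0+T']$ with $0<T'\le T$ coincides with $x$ there. Suppose that for some integer $\mu\ge 0$ the solution $x$ is $\mu$ times continuously differentiable on $[t_0,t_0+T]$ and the $n(\mu+1)\times p$ Jacobian matrix $$\mathcal I_{11}=\frac{\partial}{\partial\theta}\begin{bmatrix}A(\theta)x\\A(\theta)\dot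 x\\\vdots\\A(\theta)x^{(\mu)}\end{bmatrix},$$ taken with $x,\dot x,\dots,x^{(\mu)}$ held fixed at their values at time $t_0$ and evaluated at $\theta=\theta_0$, has rank $p$. Then the system is locally identifiable at $x_0$ with respect to $\theta_0$: there is a neighbourhood $\mathcal U\subseteq\mathbb R^p$ of $\theta_0$ such that for every $\theta'\in\mathcal U$ with $\theta'\neq\theta_0$ for which $x_0$ is consistent, there is a finite time interval $[t_0,t_0+T'']$, $T''>0$, on which trajectories starting at $x_0$ at time $t_0$ exist both for $\theta_0$ and for $\theta'$, and on which the output of any trajectory for $\theta_0$ starting at $x_0$ differs (at some time) from the output of any trajectory for $\theta'$ starting at $x_0$. -/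

import Mathlib

open scoped Topology

/-- A parametrised autonomous descriptor system `0 = F(x, ẋ; θ)`, `y = h(x; θ)` with state
`x ∈ ℝⁿ`, parameter `θ ∈ ℝᵖ` and output `y ∈ ℝ^q`. -/
structure DescriptorSystem (n p q : ℕ) where
  /-- the implicit dynamics `F(x, ẋ; θ)` -/
  F : (Fin n → ℝ) → (Fin n → ℝ) → (Fin p → ℝ) → (Fin n → ℝ)
  /-- the measurement function `h(x; θ)` -/
  h : (Fin n → ℝ) → (Fin p → ℝ) → (Fin q → ℝ)

namespace DescriptorSystem

variable {n p q : ℕ}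

/-- `x` is a (classical, continuously differentiable) solution on `[t₀, t₀ + T]`, for the parameter
value `θ`, of the initial value problem `x(t₀) = x₀`. Derivatives at the end points are
one-sided. -/
def IsSolution (S : DescriptorSystem n p q) (θ : Fin p → ℝ) (t₀ : ℝ) (x₀ : Fin n → ℝ) (T : ℝ)
    (x : ℝ → Fin n → ℝ) : Prop :=
  x t₀ = x₀ ∧ ContDiffOn ℝ 1 x (Set.Icc t₀ (t₀ + T)) ∧
    ∀ t ∈ Set.Icc t₀ (t₀ + T),
      S.F (x t) (derivWithin x (Set.Icc t₀ (t₀ + T)) t) θ = 0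

/-- `x₀` is a consistent state for the parameter value `θ`: the initial value problem
`x(t₀) = x₀` has at least one local solution. -/
def IsConsistent (S : DescriptorSystem n p q) (θ : Fin p → ℝ) (t₀ : ℝ) (x₀ : Fin n → ℝ) : Prop :=
  ∃ T > 0, ∃ x, S.IsSolution θ t₀ x₀ T x

/-- `x` is the unique local solution of the initial value problem `x(t₀) = x₀`: it is a solution
on `[t₀, t₀ + T]`, and every solution on a shorter interval `[t₀, t₀ + T']` coincides with it
there. -/
def IsUniqueSolution (S : DescriptorSystem n p q) (θ : Fin p → ℝ) (t₀ : ℝ) (x₀ : Fin n → ℝ)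
    (T : ℝ) (x : ℝ → Fin n → ℝ) : Prop :=
  S.IsSolution θ t₀ x₀ T x ∧
    ∀ T' > 0, T' ≤ T → ∀ x', S.IsSolution θ t₀ x₀ T' x' → Set.EqOn x' x (Set.Icc t₀ (t₀ + T'))

/-- Local identifiability at the consistent state `x₀` with respect to the parameter value `θ₀`:
there is a neighbourhood `U` of `θ₀` such that, for every `θ' ∈ U` with `θ' ≠ θ₀`, the outputs
of the trajectories issued from `x₀` under `θ₀` and under `θ'` are different on some finite time
interval `[t₀, t₀ + T]` on which both trajectories exist. (If `x₀` is not consistent for `θ'`, then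
there is no trajectory under `θ'` to be compared.) -/
def LocallyIdentifiable (S : DescriptorSystem n p q) (t₀ : ℝ) (x₀ : Fin n → ℝ)
    (θ₀ : Fin p → ℝ) : Prop :=
  S.IsConsistent θ₀ t₀ x₀ ∧
  ∃ U ∈ 𝓝 θ₀, ∀ θ' ∈ U, θ' ≠ θ₀ → S.IsConsistent θ' t₀ x₀ →
    ∃ T > 0, (∃ x, S.IsSolution θ₀ t₀ x₀ T x) ∧ (∃ x', S.IsSolution θ' t₀ x₀ T x') ∧
      ∀ x x', S.IsSolution θ₀ t₀ x₀ T x → S.IsSolution θ' t₀ x₀ T x' →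
        ∃ t ∈ Set.Icc t₀ (t₀ + T), S.h (x t) θ₀ ≠ S.h (x' t) θ'

/-- The linear descriptor system `E ẋ = A(θ) x`, `y = C x`. -/
def linear (E : Matrix (Fin n) (Fin n) ℝ) (A : (Fin p → ℝ) → Matrix (Fin n) (Fin n) ℝ)
    (C : Matrix (Fin q) (Fin n) ℝ) : DescriptorSystem n p q where
  F x v θ := (A θ).mulVec x - E.mulVec v
  h x _ := C.mulVec x

/-- The stacked vector `[A(θ) z₀; A(θ) z₁; …; A(θ) z_μ]`. -/
def stacked (A : (Fin p → ℝ) → Matrix (Fin n) (Fin n) ℝ) (μ : ℕ) (z : ℕ → Fin n → ℝ)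
    (θ : Fin p → ℝ) : Fin (μ + 1) × Fin n → ℝ :=
  fun ki => (A θ).mulVec (z ki.1) ki.2

/-- The block `I₁₁(θ, z)`, with `z = (x, ẋ, …, x^(μ))`: the `n(μ+1) × p` Jacobian matrix with
respect to `θ` (with `z` fixed) of `[A(θ) x; A(θ) ẋ; …; A(θ) x^(μ)]`. -/
noncomputable def identifiabilityBlock (A : (Fin p → ℝ) → Matrix (Fin n) (Fin n) ℝ) (μ : ℕ)
    (θ : Fin p → ℝ) (z : ℕ → Fin n → ℝ) : Matrix (Fin (μ + 1) × Fin n) (Fin p) ℝ :=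
  LinearMap.toMatrix' (fderiv ℝ (stacked A μ z) θ).toLinearMap

end DescriptorSystem

/-! Since `C = 1`, equal outputs mean equal trajectories, and by uniqueness both are `x`. So `x`
solves both systems on a short interval; `E ẋ` cancels, leaving `A(θ₀) x = A(θ') x`. Differentiating
this at `t₀` up to order `μ` shows that `stacked` has the same value at `θ₀` and `θ'`
(`stacked_eq_of_eqOn`). Its derivative at `θ₀` is injective by the rank condition, so that value is
not taken again near `θ₀` (`eventually_stacked_ne`). As `E ẋ` is never differentiated, `C^μ`
regularity of `x` suffices. -/

theorem Matrix.mulVec_injective_of_rank_eq_card {m n K : Type*} [Fintype m] [Fintype n] [Field K]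
    {M : Matrix m n K} (h : M.rank = Fintype.card n) : Function.Injective M.mulVec := by
  have hk : Module.finrank K (LinearMap.ker M.mulVecLin) = 0 := by
    have := M.mulVecLin.finrank_range_add_finrank_ker
    rw [Module.finrank_fintype_fun_eq_card] at this
    rw [Matrix.rank] at h
    omega
  have hb : LinearMap.ker M.mulVecLin = ⊥ := Submodule.finrank_eq_zero.mp hk
  exact LinearMap.ker_eq_bot.mp hb

theorem ContinuousLinearMap.iteratedDerivWithin_comp_left {E F : Type*}
    [NormedAddCommGroup E] [NormedSpace ℝ E] [NormedAddCommGroup F] [NormedSpace ℝ F]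
    (L : E →L[ℝ] F) {f : ℝ → E} {s : Set ℝ} {t : ℝ} {N : WithTop ℕ∞}
    (hf : ContDiffWithinAt ℝ N f s t) (hs : UniqueDiffOn ℝ s) (ht : t ∈ s) {k : ℕ} (hk : k ≤ N) :
    iteratedDerivWithin k (L ∘ f) s t = L (iteratedDerivWithin k f s t) := by
  simp only [iteratedDerivWithin_eq_iteratedFDerivWithin,
    L.iteratedFDerivWithin_comp_left hf hs ht hk]
  rfl

/-- Two linear maps that agree along a curve near `t` agree on its derivatives at `t`. -/
theorem ContinuousLinearMap.map_iteratedDerivWithin_eq_of_eventuallyEq {E F : Type*}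
    [NormedAddCommGroup E] [NormedSpace ℝ E] [NormedAddCommGroup F] [NormedSpace ℝ F]
    (L L' : E →L[ℝ] F) {f : ℝ → E} {s : Set ℝ} {t : ℝ} {N : WithTop ℕ∞}
    (hf : ContDiffWithinAt ℝ N f s t) (hs : UniqueDiffOn ℝ s) (ht : t ∈ s)
    (h : L ∘ f =ᶠ[𝓝[s] t] L' ∘ f) {k : ℕ} (hk : k ≤ N) :
    L (iteratedDerivWithin k f s t) = L' (iteratedDerivWithin k f s t) := by
  rw [← L.iteratedDerivWithin_comp_left hf hs ht hk, ← L'.iteratedDerivWithin_comp_left hf hs ht hk,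
    iteratedDerivWithin_eq_iteratedFDerivWithin, iteratedDerivWithin_eq_iteratedFDerivWithin,
    h.iteratedFDerivWithin_eq (h.self_of_nhdsWithin ht)]

namespace DescriptorSystem

theorem IsSolution.mono {n p q : ℕ} {S : DescriptorSystem n p q} {θ : Fin p → ℝ} {t₀ : ℝ}
    {x₀ : Fin n → ℝ} {T T' : ℝ} {x : ℝ → Fin n → ℝ} (h : S.IsSolution θ t₀ x₀ T x)
    (hT' : 0 < T') (hle : T' ≤ T) : S.IsSolution θ t₀ x₀ T' x := by
  have hsub : Set.Icc t₀ (t₀ + T') ⊆ Set.Icc t₀ (t₀ + T) := Set.Icc_subset_Icc le_rfl (by linarith)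
  refine ⟨h.1, h.2.1.mono hsub, fun t ht => ?_⟩
  -- `0 < T'` matters: on a one-point interval `derivWithin` is zero by default.
  rw [derivWithin_subset hsub (uniqueDiffOn_Icc (by linarith) t ht)
    (h.2.1.differentiableOn one_ne_zero t (hsub ht))]
  exact h.2.2 t (hsub ht)

theorem differentiableAt_stacked {n p : ℕ} {A : (Fin p → ℝ) → Matrix (Fin n) (Fin n) ℝ}
    {θ : Fin p → ℝ} (hA : ∀ i j, DifferentiableAt ℝ (fun θ => A θ i j) θ) (μ : ℕ)
    (z : ℕ → Fin n → ℝ) : DifferentiableAt ℝ (stacked A μ z) θ := by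
  refine differentiableAt_pi.mpr fun ki => ?_
  simp only [stacked, Matrix.mulVec, dotProduct]
  exact DifferentiableAt.fun_sum fun j _ => (hA ki.2 j).mul_const _

/-- Full column rank of the Jacobian makes the stacked map locally injective at the base point. -/
theorem eventually_stacked_ne {n p : ℕ} {A : (Fin p → ℝ) → Matrix (Fin n) (Fin n) ℝ}
    {θ₀ : Fin p → ℝ} (hA : ∀ i j, DifferentiableAt ℝ (fun θ => A θ i j) θ₀) {μ : ℕ}
    {z : ℕ → Fin n → ℝ} (hrank : (identifiabilityBlock A μ θ₀ z).rank = p) :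
    ∀ᶠ θ in 𝓝[≠] θ₀, stacked A μ z θ ≠ stacked A μ z θ₀ := by
  refine (differentiableAt_stacked hA μ z).hasFDerivAt.eventually_ne ?_
  have hinj : Function.Injective (fderiv ℝ (stacked A μ z) θ₀) := by
    intro v w hvw
    refine Matrix.mulVec_injective_of_rank_eq_card (hrank.trans (Fintype.card_fin p).symm) ?_
    simpa only [identifiabilityBlock, LinearMap.toMatrix'_mulVec, ContinuousLinearMap.coe_coe]
      using hvw
  -- In finite dimension injectivity gives a lower bound `‖v‖ ≤ K ‖Dv‖`, which dominates the
  -- `o(‖v‖)` remainder; differentiability at the single point `θ₀` is enough.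
  obtain ⟨K, -, hK⟩ := (fderiv ℝ (stacked A μ z) θ₀).toLinearMap.exists_antilipschitzWith
    (LinearMap.ker_eq_bot.mpr hinj)
  exact ⟨K, hK⟩

/-- If `A θ` and `A θ'` agree along a curve after `t₀`, the stacked maps agree at `θ` and `θ'`. -/
theorem stacked_eq_of_eqOn {n p : ℕ} {A : (Fin p → ℝ) → Matrix (Fin n) (Fin n) ℝ}
    {θ θ' : Fin p → ℝ} {t₀ T T' : ℝ} {x : ℝ → Fin n → ℝ} {μ : ℕ} (hT : 0 < T) (hT' : 0 < T')
    (hx : ContDiffOn ℝ μ x (Set.Icc t₀ (t₀ + T)))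
    (h : Set.EqOn (fun t => (A θ).mulVec (x t)) (fun t => (A θ').mulVec (x t))
      (Set.Icc t₀ (t₀ + T'))) :
    stacked A μ (fun k => iteratedDerivWithin k x (Set.Icc t₀ (t₀ + T)) t₀) θ =
      stacked A μ (fun k => iteratedDerivWithin k x (Set.Icc t₀ (t₀ + T)) t₀) θ' := by
  have ht₀ : t₀ ∈ Set.Icc t₀ (t₀ + T) := Set.left_mem_Icc.mpr (by linarith)
  -- The derivatives are taken within the long interval, but depend only on the germ at `t₀`.
  have hev : ∀ᶠ t in 𝓝[Set.Icc t₀ (t₀ + T)] t₀, (A θ).mulVec (x t) = (A θ').mulVec (x t) := by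
    filter_upwards [self_mem_nhdsWithin,
      mem_nhdsWithin_of_mem_nhds (Iic_mem_nhds (show t₀ < t₀ + T' by linarith))] with t h₁ h₂
    exact h ⟨h₁.1, h₂⟩
  funext ki
  exact congrFun (ContinuousLinearMap.map_iteratedDerivWithin_eq_of_eventuallyEq
    (A θ).mulVecLin.toContinuousLinearMap (A θ').mulVecLin.toContinuousLinearMap (hx t₀ ht₀)
    (uniqueDiffOn_Icc (by linarith)) ht₀ hev
    (by exact_mod_cast Nat.lt_succ_iff.mp ki.1.isLt)) ki.2

end DescriptorSystem

theorem corollary3 {n p : ℕ} (E : Matrix (Fin n) (Fin n) ℝ)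
    (A : (Fin p → ℝ) → Matrix (Fin n) (Fin n) ℝ)
    (t₀ : ℝ) (x₀ : Fin n → ℝ) (θ₀ : Fin p → ℝ)
    (hA : ∀ i j, DifferentiableAt ℝ (fun θ => A θ i j) θ₀)
    (T : ℝ) (hT : 0 < T) (x : ℝ → Fin n → ℝ)
    (hx : (DescriptorSystem.linear E A (1 : Matrix (Fin n) (Fin n) ℝ)).IsUniqueSolution
      θ₀ t₀ x₀ T x)
    (μ : ℕ) (hsmooth : ContDiffOn ℝ μ x (Set.Icc t₀ (t₀ + T)))
    (hrank : (DescriptorSystem.identifiabilityBlock A μ θ₀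
      (fun k => iteratedDerivWithin k x (Set.Icc t₀ (t₀ + T)) t₀)).rank = p) :
    (DescriptorSystem.linear E A (1 : Matrix (Fin n) (Fin n) ℝ)).LocallyIdentifiable
      t₀ x₀ θ₀ := by
  refine ⟨⟨T, hT, x, hx.1⟩, _,
    eventually_nhdsWithin_iff.mp (DescriptorSystem.eventually_stacked_ne hA hrank), ?_⟩
  rintro θ' hθ' hne ⟨T₁, hT₁, x₁, hx₁⟩
  have hpos : 0 < min T T₁ := lt_min hT hT₁
  -- `x₁` only witnesses existence; the trajectories compared are arbitrary.
  refine ⟨min T T₁, hpos, ⟨x, hx.1.mono hpos (min_le_left _ _)⟩,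
    ⟨x₁, hx₁.mono hpos (min_le_right _ _)⟩, fun y y' hy hy' => ?_⟩
  by_contra! hout
  have hyx := hx.2 _ hpos (min_le_left _ _) y hy
  have hyy : Set.EqOn y' y (Set.Icc t₀ (t₀ + min T T₁)) := fun t ht => by
    simpa [DescriptorSystem.linear] using (hout t ht).symm
  refine hθ' hne (DescriptorSystem.stacked_eq_of_eqOn hT hpos hsmooth fun t ht => ?_)
  have h₁ := hy.2.2 t ht
  have h₂ := hy'.2.2 t ht
  simp only [DescriptorSystem.linear, sub_eq_zero] at h₁ h₂
  rw [derivWithin_congr hyy (hyy ht), hyy ht, ← h₁, hyx ht] at h₂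
  exact h₂
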